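/- The Fishburn numbers $\xi(n)$ are the integers defined by the formal power series $$\sum_{n\ge 0}\xi(n)q^n=\sum_{n\ge 0}(1-q;1-q)_n,\qquad (A;q)_n=\prod_{k=0}^{n-1}\left(1-Aq^{k}\right),$$ so that $(1-q;1-q)_n=\prod_{j=1}^{n}\left(1-(1-q)^j\right)$, with value $1$ for $n=0$. For a positive integer $p$ let $$S(p)=\{\,j : 0\le j\le p-1,\ k(3k-1)/2\equiv j \pmod p \text{ for some } k\in\mathbb{Z}\,\}$$ be the set of residues modulo $p$ of the pentagonal numbers $k(3k-1)/2$, $k\in\mathbb{Z}$, and let $$T(p)=\{\,i : 0\le i\le p-1,\ i>j \text{ for every } j\in S(p)\,\}.$$ Theorem. If $p$ is a prime and $i\in T(p)$, then $\xi(pn+i)\equiv 0\pmod p$ for all $n\ge 0$. In particular, for all $n\ge 0$, $\xi(5n+3)\equiv\xi(5n+4)\equiv 0\pmod 5$ and $\xi(7n+6)\equiv 0\pmod 7$. -/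

import Mathlib

namespace Fishburn

open PowerSeries

/-- The `q`-shifted factorial `(A; q)_n = (1 - A) (1 - A q) ⋯ (1 - A q ^ (n - 1))`. -/
def qPoch {R : Type*} [CommRing R] (A q : R) (n : ℕ) : R :=
  ∏ k ∈ Finset.range n, (1 - A * q ^ k)

/-- The `n`-th term `(1 - q; 1 - q)_n` as a formal power series in `q = X` over `ℤ`. -/
noncomputable def term (n : ℕ) : PowerSeries ℤ :=
  qPoch (1 - X : PowerSeries ℤ) (1 - X) n

open scoped PowerSeries.WithPiTopology in
/-- The formal power series `∑_{n ≥ 0} (1 - q; 1 - q)_n`. The sum is taken coefficientwise: the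
topology on `ℤ⟦X⟧` is that of coefficientwise convergence, with `ℤ` discrete. -/
noncomputable def genFun : PowerSeries ℤ := ∑' n : ℕ, term n

/-- The Fishburn numbers `ξ(n)`, the coefficients of the formal power series `genFun`. -/
noncomputable def fishburn (n : ℕ) : ℤ := coeff n genFun

/-- The `n`-th term is divisible by `X ^ n`. -/
theorem X_pow_dvd_term (n : ℕ) : (X : PowerSeries ℤ) ^ n ∣ term n := by
  have h : ∏ _k ∈ Finset.range n, (X : PowerSeries ℤ) ∣ term n := by
    refine Finset.prod_dvd_prod_of_dvd _ _ fun k _ => ?_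
    rw [X_dvd_iff]
    simp
  simpa using h

open scoped PowerSeries.WithPiTopology in
/-- The sum defining `genFun` converges, so that `genFun` is not a default value. -/
theorem summable_term : Summable term := by
  rw [PowerSeries.WithPiTopology.summable_iff_summable_coeff]
  intro d
  refine summable_of_ne_finset_zero (s := Finset.range (d + 1)) fun n hn => ?_
  exact X_pow_dvd_iff.1 (X_pow_dvd_term n) d (by simpa using hn)

open scoped PowerSeries.WithPiTopology in
/-- The coefficients of `genFun` are finite sums of coefficients of the terms. -/
theorem fishburn_eq_sum (d : ℕ) :
    fishburn d = ∑ n ∈ Finset.range (d + 1), coeff d (term n) := by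
  have h := ((PowerSeries.WithPiTopology.hasSum_iff_hasSum_coeff ℤ).1 summable_term.hasSum) d
  refine h.unique (hasSum_sum_of_ne_finset_zero fun n hn => ?_)
  exact X_pow_dvd_iff.1 (X_pow_dvd_term n) d (by simpa using hn)

/-- `S(p)`: the residues `0 ≤ j ≤ p - 1` that are congruent modulo `p` to a pentagonal number
`k (3 k - 1) / 2`, where `k` ranges over all integers. -/
def S (p : ℕ) : Set ℕ := {j | j < p ∧ ∃ k : ℤ, pentagonal k ≡ j [MOD p]}

/-- `T(p)`: the residues `0 ≤ i ≤ p - 1` that are larger than every element of `S(p)`. -/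
def T (p : ℕ) : Set ℕ := {i | i < p ∧ ∀ j ∈ S p, j < i}

end Fishburn

namespace Fishburn

open PowerSeries

/-! For odd `p` work in `𝔽_p[X]/(X ^ p ^ r)` with `q = 1 - X`, so that `q ^ K = 1` for `K = p ^ r`
and `1 - q` is nilpotent. The Rogers-Fine series satisfies a functional equation relating `x` to `x
* q`; after `K` iterations it returns to `x`, and for `x = 1 - ε`, `ε ^ 2 = 0`, it closes up to an
equation for twice the series (`two_mul_sum_qPoch`). Its `ε`-coefficient makes `2 ∑ (q; q)_n` a
combination of pentagonal powers of `1 - X`. By Lucas, such a power has zero coefficient at `X ^ d`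
if the residue of its exponent is below that of `d`, which is what `T p` ensures. -/

theorem qPoch_succ {R : Type*} [CommRing R] (A q : R) (n : ℕ) :
    qPoch A q (n + 1) = qPoch A q n * (1 - A * q ^ n) :=
  Finset.prod_range_succ _ _

theorem qPoch_succ' {R : Type*} [CommRing R] (A q : R) (n : ℕ) :
    qPoch A q (n + 1) = (1 - A) * qPoch (A * q) q n := by
  simp only [qPoch, Finset.prod_range_succ', pow_zero, mul_one]
  rw [mul_comm]
  congr 1
  exact Finset.prod_congr rfl fun k _ => by ring

theorem map_qPoch {R R' : Type*} [CommRing R] [CommRing R'] (f : R →+* R') (A q : R) (n : ℕ) :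
    f (qPoch A q n) = qPoch (f A) (f q) n := by
  simp [qPoch]

/-! ### The Rogers-Fine functional equation and its iteration -/

/-- The partial sums `∑_{n < N} (x; q)_{n + 1} x ^ n` of a series of Rogers and Fine. -/
def fineSum {R : Type*} [CommRing R] (x q : R) (N : ℕ) : R :=
  ∑ n ∈ Finset.range N, qPoch x q (n + 1) * x ^ n

/-- The functional equation with an explicit remainder, which holds in any commutative ring and so
needs no convergence. The remainder vanishes once `qPoch (x * q) q N = 0`. -/
theorem fineSum_add_eq {R : Type*} [CommRing R] (x q : R) (N : ℕ) :
    fineSum x q N + q ^ 2 * x ^ 3 * fineSum (x * q) q N =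
      1 - q * x ^ 2 - qPoch (x * q) q N * x ^ N * (1 - q ^ (N + 1) * x ^ 2) := by
  induction N with
  | zero => simp [fineSum, qPoch]
  | succ N ih =>
    have h1 : fineSum x q (N + 1) = fineSum x q N + (1 - x) * qPoch (x * q) q N * x ^ N := by
      rw [fineSum, Finset.sum_range_succ, qPoch_succ' x, fineSum]
    have h2 : fineSum (x * q) q (N + 1) =
        fineSum (x * q) q N + qPoch (x * q) q N * (1 - x * q * q ^ N) * (x * q) ^ N := by
      rw [fineSum, Finset.sum_range_succ, qPoch_succ, fineSum]
    rw [h1, h2, qPoch_succ]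
    linear_combination ih

theorem fineSum_eq {R : Type*} [CommRing R] {x q : R} {N : ℕ} (h : qPoch (x * q) q N = 0) :
    fineSum x q N = 1 - q * x ^ 2 - q ^ 2 * x ^ 3 * fineSum (x * q) q N := by
  have := fineSum_add_eq x q N
  rw [h] at this
  linear_combination this

theorem pentagonal_add_one (k : ℕ) :
    pentagonal ((k : ℤ) + 1) = pentagonal (-(k : ℤ)) + (2 * k + 1) := by
  have h1 := two_mul_natCast_pentagonal ((k : ℤ) + 1)
  have h2 := two_mul_natCast_pentagonal_neg (k : ℤ)
  have : (2 : ℤ) * pentagonal ((k : ℤ) + 1) = 2 * (pentagonal (-(k : ℤ)) + (2 * k + 1)) := by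
    linear_combination h1 - h2
  omega

theorem pentagonal_neg_succ (k : ℕ) :
    pentagonal (-((k + 1 : ℕ) : ℤ)) = pentagonal (-(k : ℤ)) + (3 * k + 2) := by
  have h1 := two_mul_natCast_pentagonal_neg ((k + 1 : ℕ) : ℤ)
  have h2 := two_mul_natCast_pentagonal_neg (k : ℤ)
  push_cast at h1 ⊢
  have : (2 : ℤ) * pentagonal (-((k : ℤ) + 1)) = 2 * (pentagonal (-(k : ℤ)) + (3 * k + 2)) := by
    linear_combination h1 - h2
  omega

/-- The truncated partial theta expansion of the Rogers-Fine series. -/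
theorem fineSum_eq_partial_theta {R : Type*} [CommRing R] {x q : R} {N : ℕ}
    (h : ∀ j, qPoch (x * q ^ j) q N = 0) (K : ℕ) :
    fineSum x q N =
      ∑ k ∈ Finset.range K, (-1) ^ k * x ^ (3 * k) *
        (q ^ pentagonal (-(k : ℤ)) - q ^ pentagonal ((k : ℤ) + 1) * x ^ 2) +
      (-1) ^ K * x ^ (3 * K) * q ^ pentagonal (-(K : ℤ)) * fineSum (x * q ^ K) q N := by
  induction K with
  | zero => simp [pentagonal_def]
  | succ K ih =>
    have hK : qPoch (x * q ^ K * q) q N = 0 := by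
      rw [mul_assoc, ← pow_succ]
      exact h _
    rw [ih, fineSum_eq hK, Finset.sum_range_succ, pentagonal_neg_succ, pentagonal_add_one,
      mul_assoc x, ← pow_succ q K]
    ring

/-! ### Dual numbers: first order expansion at `x = 1` -/

section DualNumber

open DualNumber

variable {R : Type*} [CommRing R]

theorem eps_mul_qPoch (a q : R[ε]) (n : ℕ) :
    ε * qPoch ((1 - ε) * a) q n = ε * qPoch a q n := by
  induction n with
  | zero => simp [qPoch]
  | succ n ih =>
    rw [qPoch_succ, qPoch_succ]
    linear_combination (1 - (1 - ε) * a * q ^ n) * ih +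
      a * q ^ n * qPoch a q n * (DualNumber.eps_mul_eps (R := R))

/-- The first factor of each `qPoch (1 - ε) q (n + 1)` is `ε`, which kills every further `ε`. -/
theorem fineSum_one_sub_eps (q : R[ε]) (N : ℕ) :
    fineSum (1 - ε) q N = ε * ∑ n ∈ Finset.range N, qPoch q q n := by
  rw [fineSum, Finset.mul_sum]
  refine Finset.sum_congr rfl fun n _ => ?_
  have h : ∀ n : ℕ, ε * (1 - ε : R[ε]) ^ n = ε := by
    intro n
    induction n with
    | zero => simp
    | succ n ih =>
      rw [pow_succ, ← mul_assoc, ih, mul_sub, mul_one, DualNumber.eps_mul_eps, sub_zero]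
  have h2 := eps_mul_qPoch q q n
  rw [qPoch_succ', sub_sub_cancel, h2, mul_right_comm, h]

theorem one_sub_eps_pow (n : ℕ) : (1 - ε : R[ε]) ^ n = 1 - (n : R[ε]) * ε := by
  induction n with
  | zero => simp
  | succ n ih =>
    rw [pow_succ, ih]
    push_cast
    linear_combination (n : R[ε]) * (DualNumber.eps_mul_eps (R := R))

/-- Every factor lies in the ideal `(1 - q, ε)`, and `ε` can be used at most once. Thus the product
vanishes when `(1 - q) ^ n = 0`. -/
theorem exists_qPoch_one_sub_eps (q : R[ε]) (j n : ℕ) :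
    ∃ c d : R[ε], qPoch ((1 - ε) * q ^ j) q (n + 1) = (1 - q) ^ n * ((1 - q) * c + ε * d) := by
  have hf (m : ℕ) : ∃ c d : R[ε], 1 - (1 - ε) * q ^ m = (1 - q) * c + ε * d := by
    obtain ⟨c, hc⟩ := sub_dvd_pow_sub_pow 1 q m
    rw [one_pow] at hc
    exact ⟨c, q ^ m, by linear_combination hc⟩
  induction n with
  | zero => simpa [qPoch] using hf j
  | succ n ih =>
    obtain ⟨c, d, h⟩ := ih
    obtain ⟨c', d', h'⟩ := hf (j + (n + 1))
    refine ⟨c * c', c * d' + d * c', ?_⟩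
    rw [qPoch_succ, h, mul_assoc (1 - ε), ← pow_add, h']
    linear_combination (1 - q) ^ n * d * d' * (DualNumber.eps_mul_eps (R := R))

end DualNumber

/-- For odd `K` the number `K (3 K + 1) / 2` is a multiple of `K`. -/
theorem pow_pentagonal_neg_eq_one {R : Type*} [CommRing R] {q : R} {K : ℕ} (hK : Odd K)
    (hq : q ^ K = 1) : q ^ pentagonal (-(K : ℤ)) = 1 := by
  obtain ⟨m, rfl⟩ := hK
  have h : pentagonal (-((2 * m + 1 : ℕ) : ℤ)) = (2 * m + 1) * (3 * m + 2) := by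
    have := two_mul_natCast_pentagonal_neg ((2 * m + 1 : ℕ) : ℤ)
    zify
    push_cast at this ⊢
    exact mul_left_cancel₀ two_ne_zero (by linear_combination this)
  rw [h, pow_mul, hq, one_pow]

open DualNumber in
/-- The strange identity of Zagier at a `K`-th root of unity that is unipotent, where `K` is odd
and vanishes in the ring. -/
theorem two_mul_sum_qPoch {R : Type*} [CommRing R] {q : R} {K M : ℕ} (hodd : Odd K)
    (hK : (K : R) = 0) (hq : q ^ K = 1) (hM : (1 - q) ^ M = 0) :
    2 * ∑ n ∈ Finset.range (M + 1), qPoch q q n =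
      ∑ k ∈ Finset.range K, (-1) ^ k *
        ((3 * (k : R) + 2) * q ^ pentagonal ((k : ℤ) + 1) - 3 * k * q ^ pentagonal (-(k : ℤ))) := by
  let Q : R[ε] := TrivSqZeroExt.inlHom R R q
  have hQ : Q ^ K = 1 := by
    rw [← map_pow, hq, map_one]
  have hQM : (1 - Q) ^ M = 0 := by
    rw [← map_one (TrivSqZeroExt.inlHom R R), ← map_sub, ← map_pow, hM, map_zero]
  have hKε : (K : R[ε]) = 0 := by
    rw [← map_natCast (TrivSqZeroExt.inlHom R R), hK, map_zero]
  have h0 (j : ℕ) : qPoch ((1 - ε) * Q ^ j) Q (M + 1) = 0 := by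
    obtain ⟨c, d, h⟩ := exists_qPoch_one_sub_eps Q j M
    rw [h, hQM, zero_mul]
  have h := fineSum_eq_partial_theta h0 K
  -- The last term becomes minus the original series: `(1 - ε) ^ (3 * K) = 1 - 3 K ε = 1` since `K =
  -- 0` in the ring. The sign, from `K` odd, is the source of the factor `2`.
  rw [hQ, mul_one, hodd.neg_one_pow, pow_pentagonal_neg_eq_one hodd hQ, mul_one,
    one_sub_eps_pow (3 * K), Nat.cast_mul, hKε, mul_zero, zero_mul, sub_zero, mul_one,
    fineSum_one_sub_eps] at h
  have hsum : ∑ n ∈ Finset.range (M + 1), qPoch Q Q n =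
      TrivSqZeroExt.inl (∑ n ∈ Finset.range (M + 1), qPoch q q n) := by
    have := map_sum (TrivSqZeroExt.inlHom R R) (qPoch q q) (Finset.range (M + 1))
    simp only [map_qPoch] at this
    exact this.symm
  rw [hsum] at h
  have h2 := congrArg (TrivSqZeroExt.sndHom R R) h
  rw [map_add, map_sum] at h2
  simp only [one_sub_eps_pow] at h2
  have hneg (k : ℕ) : (-1 : R[ε]) ^ k = TrivSqZeroExt.inlHom R R ((-1) ^ k) := by
    rw [map_pow, map_neg, map_one]
  have hfst : TrivSqZeroExt.fst (2 : R[ε]) = 2 ∧ TrivSqZeroExt.fst (3 : R[ε]) = 3 := ⟨rfl, rfl⟩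
  simp only [hneg, Q, ← map_pow] at h2
  simp [hfst] at h2
  rw [two_mul]
  nth_rw 1 [h2]
  rw [neg_add_cancel_right]
  refine Finset.sum_congr rfl fun k _ => ?_
  ring

/-! ### Coefficients modulo `p` -/

theorem coeff_one_sub_X_pow {R : Type*} [CommRing R] (e d : ℕ) :
    coeff d ((1 - X : R⟦X⟧) ^ e) = (-1) ^ d * (e.choose d : R) := by
  have h : (1 - X : R⟦X⟧) ^ e = rescale (-1) ((1 + Polynomial.X : Polynomial R) ^ e : _) := by
    simp [rescale_X, sub_eq_add_neg]
  rw [h, coeff_rescale, Polynomial.coeff_coe, Polynomial.coeff_one_add_X_pow]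

/-- Lucas: the last base `p` digits contribute the factor `(e % p).choose (d % p) = 0`. -/
theorem coeff_one_sub_X_pow_eq_zero {p : ℕ} [Fact p.Prime] {e d : ℕ} (h : e % p < d % p) :
    coeff d ((1 - X : (ZMod p)⟦X⟧) ^ e) = 0 := by
  rw [coeff_one_sub_X_pow, (ZMod.natCast_eq_natCast_iff _ _ _).2
    Choose.choose_modEq_choose_mod_mul_choose_div_nat, Nat.choose_eq_zero_of_lt h]
  simp

/-- Modulo `p`, every coefficient of the generating function below `X ^ p ^ r` is given by that
of a combination of pentagonal powers of `1 - X`. -/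
theorem X_pow_dvd_two_mul_sum_sub {p : ℕ} [Fact p.Prime] (hp : Odd p) {r : ℕ} (hr : r ≠ 0) :
    (X : (ZMod p)⟦X⟧) ^ p ^ r ∣
      2 * ∑ n ∈ Finset.range (p ^ r + 1), qPoch (1 - X : (ZMod p)⟦X⟧) (1 - X) n -
      ∑ k ∈ Finset.range (p ^ r), (-1) ^ k *
        ((3 * (k : (ZMod p)⟦X⟧) + 2) * (1 - X : (ZMod p)⟦X⟧) ^ pentagonal ((k : ℤ) + 1) -
          3 * (k : (ZMod p)⟦X⟧) * (1 - X : (ZMod p)⟦X⟧) ^ pentagonal (-(k : ℤ))) := by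
  have hchar : (p : (ZMod p)⟦X⟧) = 0 := by
    rw [← map_natCast (PowerSeries.C (R := ZMod p)), ZMod.natCast_self, map_zero]
  have : CharP (ZMod p)⟦X⟧ p := charP_of_injective_ringHom (C_injective (R := ZMod p)) p
  let f := Ideal.Quotient.mk (Ideal.span {(X : (ZMod p)⟦X⟧) ^ p ^ r})
  have hX : f X ^ p ^ r = 0 := by
    rw [← map_pow]
    exact Ideal.Quotient.eq_zero_iff_mem.2 (Ideal.mem_span_singleton_self _)
  have h := two_mul_sum_qPoch (q := f (1 - X)) (K := p ^ r) (M := p ^ r) hp.pow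
    (by rw [← map_natCast f, Nat.cast_pow, hchar, zero_pow hr, map_zero])
    -- Frobenius: `(1 - X) ^ p ^ r = 1 - X ^ p ^ r`.
    (by rw [← map_pow, sub_pow_char_pow, one_pow, map_sub, map_pow, hX, map_one, sub_zero])
    (by rw [map_sub, map_one, sub_sub_cancel, hX])
  rw [← Ideal.mem_span_singleton, ← Ideal.Quotient.eq_zero_iff_mem]
  have hf2 : f 2 = 2 := map_ofNat f 2
  have hf3 : f 3 = 3 := map_ofNat f 3
  change f _ = 0
  simpa [map_qPoch, sub_eq_zero, hf2, hf3] using h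

theorem cast_fishburn {R : Type*} [CommRing R] {d N : ℕ} (hN : d < N) :
    (fishburn d : R) = coeff d (∑ n ∈ Finset.range N, qPoch (1 - X : R⟦X⟧) (1 - X) n) := by
  have h : fishburn d = coeff d (∑ n ∈ Finset.range N, term n) := by
    rw [fishburn_eq_sum, map_sum]
    refine Finset.sum_subset (Finset.range_subset_range.2 hN) fun n _ hn => ?_
    exact X_pow_dvd_iff.1 (X_pow_dvd_term n) d (by simpa using hn)
  rw [h, ← eq_intCast (Int.castRingHom R), ← coeff_map, map_sum]
  simp [term, map_qPoch]

theorem pentagonal_mod_mem_S {p : ℕ} (hp : 0 < p) (k : ℤ) : pentagonal k % p ∈ S p :=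
  ⟨Nat.mod_lt _ hp, k, (Nat.mod_modEq _ _).symm⟩

theorem fishburn_modEq_zero {p : ℕ} (hp : p.Prime) {i : ℕ} (hi : i ∈ T p) (n : ℕ) :
    fishburn (p * n + i) ≡ 0 [ZMOD p] := by
  have : Fact p.Prime := ⟨hp⟩
  obtain ⟨hip, hi⟩ := hi
  rcases hp.eq_two_or_odd' with rfl | hodd
  -- `T 2` is empty, because `1` is pentagonal.
  · have h1 := hi 1 ⟨one_lt_two, 1, by simp [pentagonal_def]; rfl⟩
    omega
  set d := p * n + i with hd
  have hdi : d % p = i := by rw [hd, Nat.mul_add_mod, Nat.mod_eq_of_lt hip]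
  -- The exponent `r = d + 1` is one choice for which truncation at `X ^ p ^ r` keeps the
  -- coefficient of `X ^ d`.
  have hlt : d < p ^ (d + 1) := (Nat.lt_succ_self d).trans (Nat.lt_pow_self hp.one_lt)
  have h0 (k : ℤ) (c : ℕ) : coeff d ((c : (ZMod p)⟦X⟧) * (1 - X) ^ pentagonal k) = 0 := by
    rw [← map_natCast (PowerSeries.C (R := ZMod p)), coeff_C_mul,
      coeff_one_sub_X_pow_eq_zero (hdi ▸ hi _ (pentagonal_mod_mem_S hp.pos k)), mul_zero]
  have h := X_pow_dvd_iff.1 (X_pow_dvd_two_mul_sum_sub hodd d.succ_ne_zero) d hlt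
  rw [map_sub, sub_eq_zero, map_sum, two_mul, map_add, ← two_mul,
    ← cast_fishburn (hlt.trans (Nat.lt_succ_self _)), Finset.sum_eq_zero] at h
  · have h2 : (2 : ZMod p) ≠ 0 := by
      have : Fact (2 < p) := ⟨hp.two_le.lt_of_ne fun h => by simp [← h, Nat.odd_iff] at hodd⟩
      exact Ring.two_ne_zero (by rw [ZMod.ringChar_zmod_n]; exact this.out.ne')
    rw [← ZMod.intCast_eq_intCast_iff, Int.cast_zero]
    exact (mul_eq_zero.1 h).resolve_left h2
  · intro k _
    have ha := h0 (k + 1) (3 * k + 2)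
    have hb := h0 (-k) (3 * k)
    push_cast at ha hb
    rcases neg_one_pow_eq_or (ZMod p)⟦X⟧ k with hk | hk <;> simp [hk, ha, hb]

/-- Membership in `T p` from a bound on the residues of `k (3 k - 1)`. -/
theorem mem_T_of_forall_two_mul {p i : ℕ} (hi : i < p)
    (h : ∀ j < p, ∀ k : ZMod p, k * (3 * k - 1) = 2 * (j : ZMod p) → j < i) : i ∈ T p := by
  refine ⟨hi, ?_⟩
  rintro j ⟨hj, k, hk⟩
  refine h j hj k ?_
  have h2 := congrArg (Int.cast (R := ZMod p)) (two_mul_natCast_pentagonal k)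
  have hk' := (ZMod.natCast_eq_natCast_iff _ _ _).2 hk
  push_cast at h2
  rw [← h2, hk']

end Fishburn

theorem theorem3p1 :
    (∀ p : ℕ, p.Prime → ∀ i ∈ Fishburn.T p, ∀ n : ℕ,
      Fishburn.fishburn (p * n + i) ≡ 0 [ZMOD p]) ∧
    (∀ n : ℕ, Fishburn.fishburn (5 * n + 3) ≡ 0 [ZMOD 5] ∧
      Fishburn.fishburn (5 * n + 4) ≡ 0 [ZMOD 5]) ∧
    (∀ n : ℕ, Fishburn.fishburn (7 * n + 6) ≡ 0 [ZMOD 7]) := by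
  refine ⟨fun p hp i hi n => Fishburn.fishburn_modEq_zero hp hi n, fun n => ⟨?_, ?_⟩, fun n => ?_⟩
  · exact Fishburn.fishburn_modEq_zero Nat.prime_five
      -- In `ZMod 5` the condition is a finite check over `j` and `k`.
      (Fishburn.mem_T_of_forall_two_mul (by norm_num) (by decide)) n
  · exact Fishburn.fishburn_modEq_zero Nat.prime_five
      (Fishburn.mem_T_of_forall_two_mul (by norm_num) (by decide)) n
  · exact Fishburn.fishburn_modEq_zero Nat.prime_seven
      (Fishburn.mem_T_of_forall_two_mul (by norm_num) (by decide)) n
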